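/- For $0<\epsilon$, $0<\delta$ and positive integers $m,n,d$, let $\mathcal D_1$ denote the law of the random matrix $U=VW\in\mathbb R^{n\times d}$, where $V\in\mathbb R^{n\times d}$ has i.i.d. columns, each uniformly distributed among the $n$ canonical basis vectors of $\mathbb R^n$, and $W\in\mathbb R^{d\times d}$ is, independently of $V$, a diagonal matrix with i.i.d. Rademacher ($\pm1$ with probability $1/2$ each) diagonal entries. A deterministic matrix $\Pi\in\mathbb R^{m\times n}$ is an $(\epsilon,\delta)$-subspace-embedding for $U\sim\mathcal D_1$ if $$\Pr_{U\sim\mathcal D_1}\left\{\forall x\in\mathbb R^d:\ (1-\epsilon)\|Ux\|_2\le\|\Pi Ux\|_2\le(1+\epsilon)\|Ux\|_2\right\}\ge 1-\delta .$$ The column sparsity of $\Pi$ is the maximum number of nonzero entries in a column of $\Pi$, and for $\theta>0$ the average number of $\theta$-heavy entries of $\Pi$ is $\frac1n\sum_{j=1}^n|\{i:|\Pi_{i,j}|\ge\theta\}|$. Theorem. There exist absolute constants $\epsilon_0,\delta_0,K_0>0$ such that the following holds. For all $\epsilon\in(0,\epsilon_0)$, $\delta\in(0,\delta_0)$, all integers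 $d\ge 1/\epsilon^2$ and $n\ge K_0d^2/\delta$, and every matrix $\Pi$ with $n$ columns: if (i) the column sparsity of $\Pi$ is at most $1/(9\epsilon)$, (ii) the average number of $\sqrt{8\epsilon}$-heavy entries of $\Pi$ is at least $1/(12\epsilon)$, and (iii) $\Pi$ is an $(\epsilon,\delta)$-subspace-embedding for $U\sim\mathcal D_1$, then $\Pi$ has more than $d^2$ rows. -/

import Mathlib

namespace SubspaceEmbedding

noncomputable section

open scoped Matrix

/-- The Euclidean norm of a real vector given by its coordinates. -/
def euclNorm {k : ℕ} (x : Fin k → ℝ) : ℝ := ‖WithLp.toLp 2 x‖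

/-- The event that `P` is a subspace embedding for the (column space of the) matrix `A`
with distortion `ε`. -/
def IsEmbeddingOf {m n d : ℕ} (ε : ℝ) (P : Matrix (Fin m) (Fin n) ℝ)
    (A : Matrix (Fin n) (Fin d) ℝ) : Prop :=
  ∀ x : Fin d → ℝ,
    (1 - ε) * euclNorm (A *ᵥ x) ≤ euclNorm (P *ᵥ (A *ᵥ x)) ∧
      euclNorm (P *ᵥ (A *ᵥ x)) ≤ (1 + ε) * euclNorm (A *ᵥ x)

/-- The deterministic matrix `P` is an `(ε, δ)`-subspace-embedding for a random matrix
distributed as `D`. -/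
def IsEmbeddingFor {m n d : ℕ} (ε δ : ℝ) (P : Matrix (Fin m) (Fin n) ℝ)
    (D : PMF (Matrix (Fin n) (Fin d) ℝ)) : Prop :=
  ENNReal.ofReal (1 - δ) ≤ D.toOuterMeasure {A | IsEmbeddingOf ε P A}

/-- The matrix `V` whose column `j` is the canonical basis vector with index `c j`. -/
def selectionMatrix {n : ℕ} {J : Type} (c : J → Fin n) : Matrix (Fin n) J ℝ :=
  Matrix.of fun i j => if i = c j then 1 else 0

/-- The matrix `W` for `β = 1 / b`: its rows are indexed by `d` consecutive blocks of `b` rows;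
column `i` has the entries `σ j * √β` in the rows `j` of block `i` and zeros elsewhere. -/
def signMatrix {d b : ℕ} (σ : Fin d × Fin b → ℤˣ) : Matrix (Fin d × Fin b) (Fin d) ℝ :=
  Matrix.of fun j i => if j.1 = i then ((σ j : ℤ) : ℝ) * √(1 / (b : ℝ)) else 0

/-- The distribution `𝓓_β` with `β = 1 / b` on `n × d` matrices: the law of `U = V * W`, where the
columns of `V` are i.i.d. uniform canonical basis vectors and the signs in `W` are independent
Rademacher variables, independent of `V`. Equivalently, the pair (column choices, signs) is
uniform on the finite product space. -/
def hardDistribution (n d b : ℕ) [NeZero n] : PMF (Matrix (Fin n) (Fin d) ℝ) :=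
  (PMF.uniformOfFintype ((Fin d × Fin b → Fin n) × (Fin d × Fin b → ℤˣ))).map
    fun ω => selectionMatrix ω.1 * signMatrix ω.2

/-- Column sparsity: the maximum number of nonzero entries in a column. -/
def columnSparsity {m n : ℕ} (P : Matrix (Fin m) (Fin n) ℝ) : ℕ :=
  Finset.univ.sup fun j => (Finset.univ.filter fun i => P i j ≠ 0).card

/-- The average, over a uniformly random column, of the number of entries of absolute value at
least `θ` in that column. -/
def averageHeavy {m n : ℕ} (θ : ℝ) (P : Matrix (Fin m) (Fin n) ℝ) : ℝ :=
  (∑ j, ((Finset.univ.filter fun i => θ ≤ |P i j|).card : ℝ)) / (n : ℝ)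

end

end SubspaceEmbedding

/-! Call two distinct columns of `P` bad if one has squared length above `(1 + ε) ^ 2` or their
inner product exceeds `2 * ε` in absolute value. An embedding of `U` rules out bad pairs among the
selected columns, so the `d` random columns contain one with probability at most `δ`.

A second moment argument turns this into scarcity of bad pairs. Vertices of high degree would
inflate the variance, so the bad-pair graph is split at relative degree `1 / k`, with `k = d / 2`:
`card_high_degree_le` leaves at most `4δn/k` columns above it, and `card_low_degree_pairs_le` leaves
`T ≤ 4δn²/k²` ordered bad pairs below it.

Conversely, heavy entries create bad pairs. If the columns in `C` share a heavy row, that row alone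
contributes at least `8ε` in absolute value to each inner product, and after aligning signs the
other rows contribute a nonnegative total; hence `C` contains at least `2ε|C|² - |C|` bad pairs
(`card_bad_ge_of_heavy_row`). Summing over rows, where a pair recurs at most `s` times (`s` the
column sparsity), and applying Cauchy–Schwarz gives `2εS² ≤ m(S + sT)` for the number `S` of heavy
entries in low-degree columns. Since `S ≥ n/(24ε)`, `s ≤ 1/(9ε)` and `d² ≤ δn`, this is impossible
for `m ≤ d²` and small `δ`. -/

namespace SubspaceEmbedding

open scoped BigOperators Matrix
open Finset

/-! ### Second moment method for random vertices of a graph -/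

section SecondMoment

variable {J V : Type*} [Fintype J] [DecidableEq J] [Fintype V] [Nonempty V]

/-- Resampling one coordinate of a uniformly random function does not change expectations. -/
theorem expect_resample (b : J) (F : (J → V) → ℝ) :
    𝔼 c, F c = 𝔼 c, 𝔼 v, F (Function.update c b v) := by
  have h : ∀ G : (J → V) → ℝ, 𝔼 c, G c =
      𝔼 p : V × ({j // j ≠ b} → V), G ((Equiv.funSplitAt b V).symm p) := fun G =>
    Fintype.expect_equiv (Equiv.funSplitAt b V) _ _ fun c => by
      rw [Equiv.symm_apply_apply]
  have h2 : ∀ (p : V × ({j // j ≠ b} → V)) (v : V),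
      Function.update ((Equiv.funSplitAt b V).symm p) b v =
        (Equiv.funSplitAt b V).symm (v, p.2) := by
    intro p v
    ext j
    by_cases hj : j = b
    · subst hj; simp
    · simp [hj]
  rw [h, h]
  simp only [h2]
  rw [← univ_product_univ, expect_product, expect_product]
  dsimp only
  rw [expect_const univ_nonempty, expect_comm]

theorem expect_two {a b : J} (hab : a ≠ b) (g : V → V → ℝ) :
    𝔼 c : J → V, g (c a) (c b) = 𝔼 u, 𝔼 v, g u v := by
  rw [expect_resample b]
  simp only [Function.update_self, Function.update_of_ne hab]
  rw [expect_resample a]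
  simp only [Function.update_self]
  rw [expect_const univ_nonempty]

theorem expect_three {a b b' : J} (h₁ : a ≠ b) (h₂ : a ≠ b') (h₃ : b ≠ b')
    (g : V → V → V → ℝ) :
    𝔼 c : J → V, g (c a) (c b) (c b') = 𝔼 u, 𝔼 v, 𝔼 v', g u v v' := by
  rw [expect_resample b']
  simp only [Function.update_self, Function.update_of_ne h₂, Function.update_of_ne h₃]
  exact expect_two h₁ fun u v => 𝔼 v', g u v v'

theorem expect_four {a a' b b' : J} (h₁ : a ≠ b) (h₂ : a ≠ b') (h₃ : b ≠ b')
    (h₄ : a ≠ a') (h₅ : b ≠ a') (h₆ : b' ≠ a') (g : V → V → V → V → ℝ) :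
    𝔼 c : J → V, g (c a) (c b) (c b') (c a') = 𝔼 u, 𝔼 v, 𝔼 v', 𝔼 u', g u v v' u' := by
  rw [expect_resample a']
  simp only [Function.update_self, Function.update_of_ne h₄, Function.update_of_ne h₅,
    Function.update_of_ne h₆]
  exact expect_three h₁ h₂ h₃ fun u v v' => 𝔼 u', g u v v' u'

theorem expect_sq_row_le {V : Type*} [Fintype V] {w : V → V → ℝ} {F : ℝ} (hw : ∀ u v, 0 ≤ w u v)
    (hrow : ∀ u, 𝔼 v, w u v ≤ F) :
    𝔼 u, 𝔼 v, 𝔼 v', w u v * w u v' ≤ F * 𝔼 u, 𝔼 v, w u v := by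
  rw [mul_expect]
  refine expect_le_expect fun u _ => ?_
  rw [mul_expect]
  refine expect_le_expect fun v _ => ?_
  rw [← mul_expect, mul_comm]
  exact mul_le_mul_of_nonneg_right (hrow u) (hw u v)

/-- The correlation of two entries of a weight matrix, read at random indices. -/
theorem expect_mul_entries_le {w : V → V → ℝ} {F : ℝ} (hw : ∀ u v, 0 ≤ w u v)
    (hw1 : ∀ u v, w u v ≤ 1) (hrow : ∀ u, 𝔼 v, w u v ≤ F) (hcol : ∀ v, 𝔼 u, w u v ≤ F)
    (hF : 0 ≤ F) {A B : Finset J} (hAB : Disjoint A B) {a a' b b' : J} (ha : a ∈ A) (ha' : a' ∈ A)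
    (hb : b ∈ B) (hb' : b' ∈ B) :
    𝔼 c : J → V, w (c a) (c b) * w (c a') (c b') ≤
      (if a = a' then if b = b' then 𝔼 u, 𝔼 v, w u v else 0 else 0)
        + (if a = a' then F * 𝔼 u, 𝔼 v, w u v else 0)
        + (if b = b' then F * 𝔼 u, 𝔼 v, w u v else 0) + (𝔼 u, 𝔼 v, w u v) ^ 2 := by
  have hne : ∀ {x y : J}, x ∈ A → y ∈ B → x ≠ y := fun hx hy h =>
    (Finset.disjoint_left.mp hAB hx) (h ▸ hy)
  have hp : 0 ≤ 𝔼 u, 𝔼 v, w u v := expect_nonneg fun u _ => expect_nonneg fun v _ => hw u v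
  have hFp := mul_nonneg hF hp
  have hp2 := sq_nonneg (𝔼 u, 𝔼 v, w u v)
  -- Equal pairs use `w² ≤ w`; with one shared index the factors are independent given it, and one
  -- of them averages to at most `F`; four distinct indices give full independence.
  by_cases h1 : a = a' <;> by_cases h2 : b = b'
  · subst h1 h2
    have : 𝔼 c : J → V, w (c a) (c b) * w (c a) (c b) ≤ 𝔼 u, 𝔼 v, w u v := by
      rw [← expect_two (hne ha hb)]
      exact expect_le_expect fun c _ => mul_le_of_le_one_right (hw _ _) (hw1 _ _)
    simp only [if_true]
    linarith
  · subst h1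
    have : 𝔼 c : J → V, w (c a) (c b) * w (c a) (c b') ≤ F * 𝔼 u, 𝔼 v, w u v :=
      (expect_three (hne ha hb) (hne ha hb') h2 fun u v v' => w u v * w u v').trans_le
        (expect_sq_row_le hw hrow)
    simp only [if_true, if_neg h2]
    linarith
  · subst h2
    have : 𝔼 c : J → V, w (c a) (c b) * w (c a') (c b) ≤ F * 𝔼 u, 𝔼 v, w u v := by
      refine (expect_three (hne ha hb).symm (hne ha' hb).symm h1
        fun v u u' => w u v * w u' v).trans_le ?_
      rw [expect_comm (f := fun u v => w u v)]
      exact expect_sq_row_le (w := fun v u => w u v) (fun _ _ => hw _ _) hcol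
    simp only [if_true, if_neg h1]
    linarith
  · have : 𝔼 c : J → V, w (c a) (c b) * w (c a') (c b') = (𝔼 u, 𝔼 v, w u v) ^ 2 := by
      refine (expect_four (hne ha hb) h1 (hne ha' hb).symm (hne ha hb') h2 (hne ha' hb')
        fun u v u' v' => w u v * w u' v').trans ?_
      simp only [← mul_expect, ← expect_mul, sq]
    simp only [if_neg h1, if_neg h2]
    linarith

/-- Second moment bound: if a nonnegative weight on pairs is spread out, then random indices
hit its support with probability at least `t / (3 + t)`. -/
theorem mul_card_le_card_hit {w : V → V → ℝ} (hw : ∀ u v, 0 ≤ w u v) (hw1 : ∀ u v, w u v ≤ 1)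
    {k : ℕ} (hk : 0 < k) (hrow : ∀ u, 𝔼 v, w u v ≤ 1 / k) (hcol : ∀ v, 𝔼 u, w u v ≤ 1 / k)
    {A B : Finset J} (hAB : Disjoint A B) (hA : #A = k) (hB : #B = k) {S : Finset (J → V)}
    (hS : ∀ c a b, w (c a) (c b) ≠ 0 → c ∈ S) {t : ℝ} (ht : t = k ^ 2 * 𝔼 u, 𝔼 v, w u v) :
    t * Fintype.card (J → V) ≤ (3 + t) * #S := by
  set p := 𝔼 u, 𝔼 v, w u v with hp
  have hk' : (0 : ℝ) < k := by exact_mod_cast hk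
  have hp0 : 0 ≤ p := expect_nonneg fun u _ => expect_nonneg fun v _ => hw u v
  have ht0 : 0 ≤ t := by rw [ht]; positivity
  let X : (J → V) → ℝ := fun c => ∑ a ∈ A, ∑ b ∈ B, w (c a) (c b)
  have hX1 : 𝔼 c, X c = t := by
    simp only [X]
    rw [expect_sum_comm]
    have : ∀ a ∈ A, 𝔼 c : J → V, ∑ b ∈ B, w (c a) (c b) = k * p := by
      intro a ha
      rw [expect_sum_comm, sum_congr rfl fun b hb =>
        expect_two (disjoint_iff_ne.mp hAB a ha b hb) w]
      simp [hB, hp]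
    rw [sum_congr rfl this, sum_const, hA, ht, nsmul_eq_mul]
    ring
  -- The `k²` equal pairs contribute `k²p = t`; each of the two families of `k³` terms sharing an
  -- index contributes `k³ · p/k = t`; the product term gives `k⁴p² = t²`.
  have hX2 : 𝔼 c, X c ^ 2 ≤ 3 * t + t ^ 2 := by
    have hsq : ∀ c, X c ^ 2 =
        ∑ a ∈ A, ∑ a' ∈ A, ∑ b ∈ B, ∑ b' ∈ B, w (c a) (c b) * w (c a') (c b') := by
      intro c
      simp only [X, sq, sum_mul_sum]
    simp only [hsq]
    simp only [expect_sum_comm]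
    refine (sum_le_sum fun a ha => sum_le_sum fun a' ha' => sum_le_sum fun b hb =>
      sum_le_sum fun b' hb' =>
        expect_mul_entries_le hw hw1 hrow hcol (by positivity) hAB ha ha' hb hb').trans ?_
    rw [← hp]
    simp only [sum_add_distrib, sum_const, sum_ite_eq, hA, hB, nsmul_eq_mul, ← mul_sum]
    have e1 : ∀ a ∈ A, (∑ x ∈ A, ∑ y ∈ B, ∑ z ∈ B,
        if a = x then if y = z then p else 0 else 0) = k * p := by
      intro a ha
      rw [sum_eq_single_of_mem a ha (fun x _ hx => by simp [Ne.symm hx])]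
      simp [hB]
    have e2 : ∀ s : Finset J, #s = k → (∑ x ∈ s, if x ∈ s then 1 / (k : ℝ) * p else 0) = p := by
      intro s hs
      rw [sum_congr rfl fun x hx => if_pos hx]
      simp only [sum_const, hs, nsmul_eq_mul]
      field_simp
    rw [sum_congr rfl e1, e2 A hA, e2 B hB]
    simp only [sum_const, hA, nsmul_eq_mul]
    rw [ht]
    apply le_of_eq
    field_simp
    ring
  have hN : (0 : ℝ) < Fintype.card (J → V) := by exact_mod_cast Fintype.card_pos
  set N : ℝ := ((Fintype.card (J → V) : ℕ) : ℝ)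
  have hs1 : ∑ c, X c = N * t := by
    rw [← hX1, Fintype.expect_eq_sum_div_card]
    change _ = N * (_ / N)
    field_simp
  have hs2 : ∑ c, X c ^ 2 ≤ N * (3 * t + t ^ 2) := by
    rw [Fintype.expect_eq_sum_div_card, div_le_iff₀ hN] at hX2; linarith
  have hS1 : ∑ c ∈ S, X c = ∑ c, X c := by
    refine sum_subset (subset_univ S) fun c _ hc => ?_
    refine sum_eq_zero fun a _ => sum_eq_zero fun b _ => ?_
    by_contra h
    exact hc (hS c a b h)
  -- `X` vanishes off `S`, so Cauchy–Schwarz on `S` bounds its size from below.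
  have hCS : (∑ c ∈ S, X c) ^ 2 ≤ #S * ∑ c ∈ S, X c ^ 2 := sq_sum_le_card_mul_sum_sq
  have hS2 : ∑ c ∈ S, X c ^ 2 ≤ ∑ c, X c ^ 2 :=
    sum_le_sum_of_subset_of_nonneg (subset_univ S) fun c _ _ => sq_nonneg _
  rcases ht0.eq_or_lt with h0 | h0
  · rw [← h0]; simp
  · have : (N * t) ^ 2 ≤ #S * (N * (3 * t + t ^ 2)) := by
      rw [← hs1, ← hS1]
      exact hCS.trans (mul_le_mul_of_nonneg_left (hS2.trans hs2) (by positivity))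
    have hNt : 0 < N * t := by positivity
    refine le_of_mul_le_mul_left ?_ hNt
    nlinarith

/-- If random indices hit a spread-out weight with probability at most `δ`, its mean is small. -/
theorem mean_le_of_card_hit_le {w : V → V → ℝ} (hw : ∀ u v, 0 ≤ w u v) (hw1 : ∀ u v, w u v ≤ 1)
    {k : ℕ} (hk : 0 < k) (hrow : ∀ u, 𝔼 v, w u v ≤ 1 / k) (hcol : ∀ v, 𝔼 u, w u v ≤ 1 / k)
    {A B : Finset J} (hAB : Disjoint A B) (hA : #A = k) (hB : #B = k) {S : Finset (J → V)}
    (hS : ∀ c a b, w (c a) (c b) ≠ 0 → c ∈ S) {δ : ℝ} (hδ : δ ≤ 1 / 4)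
    (hSδ : #S ≤ δ * Fintype.card (J → V)) :
    k ^ 2 * 𝔼 u, 𝔼 v, w u v ≤ 4 * δ := by
  have h := mul_card_le_card_hit hw hw1 hk hrow hcol hAB hA hB hS rfl
  have ht : 0 ≤ k ^ 2 * 𝔼 u, 𝔼 v, w u v :=
    mul_nonneg (by positivity) (expect_nonneg fun u _ => expect_nonneg fun v _ => hw u v)
  set t := k ^ 2 * 𝔼 u, 𝔼 v, w u v
  have hN : (0 : ℝ) < Fintype.card (J → V) := by exact_mod_cast Fintype.card_pos
  have h2 : t ≤ (3 + t) * δ := by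
    refine le_of_mul_le_mul_right (h.trans ?_) hN
    rw [mul_assoc]
    exact mul_le_mul_of_nonneg_left hSδ (by linarith)
  -- `t ≤ 3δ / (1 - δ) ≤ 4δ` because `δ ≤ 1/4`.
  nlinarith

open Classical in
/-- If random indices contain a related pair with probability at most `δ`, then few vertices
are related to more than a `1 / k` fraction of all vertices. -/
theorem card_high_degree_le {E : V → V → Prop} {k : ℕ} (hk : 0 < k)
    {A B : Finset J} (hAB : Disjoint A B) (hA : #A = k) (hB : #B = k) {S : Finset (J → V)}
    (hS : ∀ c a b, E (c a) (c b) → c ∈ S) {δ : ℝ} (hδ : δ < 1 / 4)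
    (hSδ : #S ≤ δ * Fintype.card (J → V)) :
    k * (#{u | 1 / (k : ℝ) < 𝔼 v, if E u v then (1 : ℝ) else 0} : ℝ) ≤
      4 * δ * Fintype.card V := by
  set f : V → ℝ := fun u => 𝔼 v, if E u v then (1 : ℝ) else 0 with hf
  set H : Finset V := {u | 1 / (k : ℝ) < f u} with hH
  have hk' : (0 : ℝ) < k := by exact_mod_cast hk
  have hn : (0 : ℝ) < Fintype.card V := by exact_mod_cast Fintype.card_pos
  set h : ℝ := #H / Fintype.card V with hh
  have hh0 : 0 ≤ h := by positivity
  have key : ∀ l : ℝ, 0 ≤ l → l ≤ 1 / k → h * k * l ≤ 1 / k → k ^ 2 * (h * l) ≤ 4 * δ := by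
    intro l hl0 hl1 hl2
    -- Edges leaving `H` are scaled down so that every row in `H` has mean exactly `l`. As `f u > 1
    -- / k`, entries are at most `l * k`, so column means are at most `h * k * l`.
    let w : V → V → ℝ := fun u v => if u ∈ H then (l / f u) * (if E u v then 1 else 0) else 0
    have hfu : ∀ u ∈ H, 1 / (k : ℝ) < f u := fun u hu => by simpa [hH] using hu
    have hfu0 : ∀ u ∈ H, 0 < f u := fun u hu => lt_trans (by positivity) (hfu u hu)
    have hq : ∀ u ∈ H, l / f u ≤ l * k := fun u hu => by
      rw [div_le_iff₀ (hfu0 u hu)]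
      have h1 := mul_le_mul_of_nonneg_left (hfu u hu).le (mul_nonneg hl0 hk'.le)
      have h2 : l * k * (1 / k) = l := by field_simp
      linarith
    have hlk : l * k ≤ 1 := by rwa [le_div_iff₀ hk'] at hl1
    have hw0 : ∀ u v, 0 ≤ w u v := by
      intro u v
      simp only [w]
      split_ifs with h1 h2
      · have := hfu0 u h1; positivity
      · simp
      · exact le_rfl
    have hwle : ∀ u v, w u v ≤ if u ∈ H then l * k else 0 := by
      intro u v
      simp only [w]
      split_ifs with h1 h2
      · simpa using hq u h1
      · simp; positivity
      · exact le_rfl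
    have hrow : ∀ u, 𝔼 v, w u v = if u ∈ H then l else 0 := by
      intro u
      simp only [w]
      split_ifs with h1
      · rw [← mul_expect]
        exact div_mul_cancel₀ _ (hfu0 u h1).ne'
      · simp
    have hmeanH : ∀ x : ℝ, (𝔼 u : V, if u ∈ H then x else 0) = h * x := by
      intro x
      rw [Fintype.expect_eq_sum_div_card, sum_ite_mem, univ_inter, sum_const, nsmul_eq_mul, hh]
      ring
    have := mean_le_of_card_hit_le (w := w) hw0
      (fun u v => (hwle u v).trans (by split_ifs <;> linarith)) hk
      (fun u => by rw [hrow]; split_ifs; exacts [hl1, by positivity])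
      (fun v => by
        refine (expect_le_expect fun u _ => hwle u v).trans ?_
        rw [hmeanH]; linarith)
      hAB hA hB (S := S) (fun c a b hc => hS c a b (by
        by_contra hE
        exact hc (by simp [w, hE]))) hδ.le hSδ
    simpa only [hrow, hmeanH] using this
  -- Otherwise `l = 1 / (h * k ^ 2)` is admissible and `key` yields `1 ≤ 4δ`. Once `h * k ≤ 1` is
  -- known, `l = 1 / k` is admissible.
  have hhk : h * k ≤ 1 := by
    by_contra hcon
    push Not at hcon
    have hhpos : 0 < h := by
      by_contra h0
      have : h = 0 := le_antisymm (not_lt.mp h0) hh0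
      rw [this] at hcon; norm_num at hcon
    have := key (1 / (h * k ^ 2)) (by positivity)
      (by
        rw [div_le_div_iff₀ (by positivity) hk']
        nlinarith)
      (by apply le_of_eq; field_simp)
    have h1 : (k : ℝ) ^ 2 * (h * (1 / (h * k ^ 2))) = 1 := by field_simp
    linarith
  have := key (1 / k) (by positivity) le_rfl (by
    have := mul_le_mul_of_nonneg_right hhk (by positivity : (0 : ℝ) ≤ 1 / k)
    linarith)
  have h1 : (k : ℝ) ^ 2 * (h * (1 / k)) * Fintype.card V = k * #H := by
    rw [hh]; field_simp
  rw [← h1]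
  exact mul_le_mul_of_nonneg_right this hn.le

open Classical in
/-- If random indices contain a related pair with probability at most `δ`, then the relation
has few pairs among the vertices of low degree. -/
theorem card_low_degree_pairs_le {E : V → V → Prop} (hsymm : ∀ u v, E u v → E v u)
    {k : ℕ} (hk : 0 < k)
    {A B : Finset J} (hAB : Disjoint A B) (hA : #A = k) (hB : #B = k) {S : Finset (J → V)}
    (hS : ∀ c a b, E (c a) (c b) → c ∈ S) {δ : ℝ} (hδ : δ ≤ 1 / 4)
    (hSδ : #S ≤ δ * Fintype.card (J → V)) {L : Finset V}
    (hL : ∀ u ∈ L, (𝔼 v, if E u v then (1 : ℝ) else 0) ≤ 1 / k) :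
    (k : ℝ) ^ 2 * #{p ∈ L ×ˢ L | E p.1 p.2} ≤ 4 * δ * (Fintype.card V : ℝ) ^ 2 := by
  have hn : (0 : ℝ) < Fintype.card V := by exact_mod_cast Fintype.card_pos
  -- Restricted to `L`, the plain adjacency weight is already spread out: rows by the degree bound,
  -- columns by symmetry.
  let w : V → V → ℝ := fun u v => if (u ∈ L ∧ v ∈ L) ∧ E u v then 1 else 0
  have hw0 : ∀ u v, 0 ≤ w u v := fun u v => by simp only [w]; split_ifs <;> norm_num
  have hw1 : ∀ u v, w u v ≤ 1 := fun u v => by simp only [w]; split_ifs <;> norm_num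
  have hws : ∀ u v, w u v = w v u := fun u v => by
    simp only [w]
    congr 1
    exact propext ⟨fun h => ⟨h.1.symm, hsymm _ _ h.2⟩, fun h => ⟨h.1.symm, hsymm _ _ h.2⟩⟩
  have hrow : ∀ u, 𝔼 v, w u v ≤ 1 / k := by
    intro u
    by_cases hu : u ∈ L
    · refine le_trans (expect_le_expect fun v _ => ?_) (hL u hu)
      simp only [w]
      split_ifs with h1 h2 h2
      · exact le_rfl
      · exact absurd h1.2 h2
      · norm_num
      · exact le_rfl
    · simp [w, hu]
  have := mean_le_of_card_hit_le hw0 hw1 hk hrow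
    (fun v => by simpa only [hws v] using hrow v) hAB hA hB (S := S)
    (fun c a b hc => hS c a b (by
      by_contra hE
      exact hc (by simp [w, hE]))) hδ hSδ
  have hmean : (Fintype.card V : ℝ) ^ 2 * 𝔼 u, 𝔼 v, w u v = #{p ∈ L ×ˢ L | E p.1 p.2} := by
    have hcard : (#{p ∈ L ×ˢ L | E p.1 p.2} : ℝ) = ∑ u, ∑ v, w u v := by
      rw [← sum_product', univ_product_univ, ← sum_filter_add_sum_filter_not univ
        (fun p : V × V => (p.1 ∈ L ∧ p.2 ∈ L) ∧ E p.1 p.2)]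
      rw [sum_congr rfl (g := fun _ => (1 : ℝ)) (by intro p hp; simp at hp; simp [w, hp]),
        sum_eq_zero (s := univ.filter fun p : V × V => ¬ _) (by
          intro p hp; simp only [mem_filter, mem_univ, true_and] at hp; simp only [w, if_neg hp])]
      simp only [sum_const, nsmul_eq_mul, mul_one, add_zero, Nat.cast_inj]
      congr 1
      ext p
      simp
    rw [hcard]
    simp only [Fintype.expect_eq_sum_div_card]
    rw [← sum_div]
    field_simp
  rw [← hmean]
  calc _ = (k ^ 2 * 𝔼 u, 𝔼 v, w u v) * (Fintype.card V : ℝ) ^ 2 := by ring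
    _ ≤ _ := mul_le_mul_of_nonneg_right this (by positivity)

end SecondMoment

/-! ### Bad pairs of columns and the hard distribution -/

/-- The inner product of two columns of a matrix. -/
noncomputable def columnInner {m n : ℕ} (P : Matrix (Fin m) (Fin n) ℝ) (u v : Fin n) : ℝ :=
  ∑ r, P r u * P r v

/-- Two distinct columns that cannot both be selected when `P` is an embedding: one of them is too
long, or they are too far from orthogonal. -/
def IsBadPair {m n : ℕ} (ε : ℝ) (P : Matrix (Fin m) (Fin n) ℝ) (u v : Fin n) : Prop :=
  u ≠ v ∧ ¬ (columnInner P u u ≤ (1 + ε) ^ 2 ∧ columnInner P v v ≤ (1 + ε) ^ 2 ∧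
    |columnInner P u v| ≤ 2 * ε)

theorem columnInner_comm {m n : ℕ} (P : Matrix (Fin m) (Fin n) ℝ) (u v : Fin n) :
    columnInner P u v = columnInner P v u := by
  simp only [columnInner, mul_comm]

theorem IsBadPair.symm {m n : ℕ} {ε : ℝ} {P : Matrix (Fin m) (Fin n) ℝ} {u v : Fin n}
    (h : IsBadPair ε P u v) : IsBadPair ε P v u :=
  ⟨h.1.symm, fun h' => h.2 ⟨h'.2.1, h'.1, by rw [columnInner_comm]; exact h'.2.2⟩⟩

theorem euclNorm_nonneg {k : ℕ} (x : Fin k → ℝ) : 0 ≤ euclNorm x := norm_nonneg _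

theorem euclNorm_sq {k : ℕ} (x : Fin k → ℝ) : euclNorm x ^ 2 = ∑ i, x i ^ 2 := by
  simp [euclNorm, EuclideanSpace.norm_sq_eq]

theorem euclNorm_mulVec_two_sq {m n : ℕ} (P : Matrix (Fin m) (Fin n) ℝ) (u v : Fin n) (s t : ℝ) :
    euclNorm (P *ᵥ (Pi.single u s + Pi.single v t)) ^ 2 =
      s ^ 2 * columnInner P u u + 2 * s * t * columnInner P u v + t ^ 2 * columnInner P v v := by
  rw [euclNorm_sq]
  simp only [columnInner, mul_sum, ← sum_add_distrib]
  refine sum_congr rfl fun r _ => ?_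
  simp only [Matrix.mulVec_add, Matrix.mulVec_single, Pi.add_apply, Pi.smul_apply, Matrix.col_apply,
    MulOpposite.smul_eq_mul_unop, MulOpposite.unop_op]
  ring

theorem euclNorm_two_sq {n : ℕ} {u v : Fin n} (h : u ≠ v) (s t : ℝ) :
    euclNorm (Pi.single u s + Pi.single v t) ^ 2 = s ^ 2 + t ^ 2 := by
  have := euclNorm_mulVec_two_sq (1 : Matrix (Fin n) (Fin n) ℝ) u v s t
  simpa [columnInner, Matrix.one_apply, h, h.symm] using this

/-- With blocks of size one, each column of `U` is a signed basis vector, and a coefficient carrying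
the same sign cancels it. The signs therefore play no role in what the column space contains. -/
theorem selection_mul_sign_mulVec_single {n d : ℕ} (c : Fin d × Fin 1 → Fin n)
    (σ : Fin d × Fin 1 → ℤˣ) (a : Fin d × Fin 1) (s : ℝ) :
    (selectionMatrix c * signMatrix σ) *ᵥ Pi.single a.1 (((σ a : ℤ) : ℝ) * s) =
      Pi.single (c a) s := by
  have hσ : ((σ a : ℤ) : ℝ) * ((σ a : ℤ) : ℝ) = 1 := by
    rcases Int.units_eq_one_or (σ a) with h | h <;> simp [h]
  have h0 : ∀ x : Fin d × Fin 1, x.1 = a.1 ↔ x = a := fun x =>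
    ⟨fun h => Prod.ext h (Subsingleton.elim _ _), fun h => by rw [h]⟩
  ext i
  simp only [Matrix.mulVec_single, Pi.smul_apply, Matrix.col_apply, Matrix.mul_apply,
    MulOpposite.smul_eq_mul_unop, MulOpposite.unop_op, selectionMatrix, signMatrix, Matrix.of_apply,
    h0, mul_ite, mul_zero, sum_ite_eq', mem_univ, if_true, Nat.cast_one, div_one, Real.sqrt_one,
    mul_one, Pi.single_apply]
  split_ifs
  · linear_combination s * hσ
  · ring

/-- If `P` embeds the column space selected by `c`, then no two selected columns are bad. -/
theorem IsEmbeddingOf.not_isBadPair {m n d : ℕ} {ε : ℝ} (hε1 : ε ≤ 1)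
    {P : Matrix (Fin m) (Fin n) ℝ} {c : Fin d × Fin 1 → Fin n} {σ : Fin d × Fin 1 → ℤˣ}
    (h : IsEmbeddingOf ε P (selectionMatrix c * signMatrix σ)) (a b : Fin d × Fin 1) :
    ¬ IsBadPair ε P (c a) (c b) := by
  rintro ⟨hne, hbad⟩
  have key : ∀ s t : ℝ,
      (1 - ε) ^ 2 * (s ^ 2 + t ^ 2) ≤ s ^ 2 * columnInner P (c a) (c a)
        + 2 * s * t * columnInner P (c a) (c b) + t ^ 2 * columnInner P (c b) (c b) ∧
      s ^ 2 * columnInner P (c a) (c a) + 2 * s * t * columnInner P (c a) (c b)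
        + t ^ 2 * columnInner P (c b) (c b) ≤ (1 + ε) ^ 2 * (s ^ 2 + t ^ 2) := by
    intro s t
    have := h (Pi.single a.1 (((σ a : ℤ) : ℝ) * s) + Pi.single b.1 (((σ b : ℤ) : ℝ) * t))
    rw [Matrix.mulVec_add, selection_mul_sign_mulVec_single,
      selection_mul_sign_mulVec_single] at this
    rw [← euclNorm_mulVec_two_sq, ← euclNorm_two_sq hne, ← mul_pow, ← mul_pow]
    exact ⟨pow_le_pow_left₀ (mul_nonneg (by linarith) (euclNorm_nonneg _)) this.1 2,
      pow_le_pow_left₀ (euclNorm_nonneg _) this.2 2⟩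
  -- The vectors `(1, 0)` and `(0, 1)` bound the lengths; comparing `(1, 1)` with `(1, -1)` bounds
  -- four times the inner product by `2(1 + ε)² - 2(1 - ε)² = 8ε`.
  have h10 := key 1 0
  have h01 := key 0 1
  have h11 := key 1 1
  have h1m := key 1 (-1)
  refine hbad ⟨by nlinarith, by nlinarith, abs_le.mpr ⟨by nlinarith, by nlinarith⟩⟩

open Classical in
/-- An embedding of the hard distribution rarely selects a bad pair of columns. -/
theorem IsEmbeddingFor.card_bad_le {m n d : ℕ} [NeZero n] {ε δ : ℝ} (hε1 : ε ≤ 1) (hδ : δ ≤ 1) {P : Matrix (Fin m) (Fin n) ℝ}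
    (h : IsEmbeddingFor ε δ P (hardDistribution n d 1)) :
    (#{c : Fin d × Fin 1 → Fin n | ∃ a b, IsBadPair ε P (c a) (c b)} : ℝ) ≤
      δ * Fintype.card (Fin d × Fin 1 → Fin n) := by
  rw [IsEmbeddingFor, hardDistribution, PMF.toOuterMeasure_map_apply,
    PMF.toOuterMeasure_uniformOfFintype_apply, Fintype.card_prod, ← Set.toFinset_card] at h
  set N := Fintype.card (Fin d × Fin 1 → Fin n)
  set M := Fintype.card (Fin d × Fin 1 → ℤˣ)
  set S : Finset (Fin d × Fin 1 → Fin n) := {c | ∃ a b, IsBadPair ε P (c a) (c b)} with hS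
  set G := #((fun ω : (Fin d × Fin 1 → Fin n) × (Fin d × Fin 1 → ℤˣ) =>
    selectionMatrix ω.1 * signMatrix ω.2) ⁻¹' {A | IsEmbeddingOf ε P A}).toFinset
  have hG : G ≤ (N - #S) * M := by
    have h1 : #(Sᶜ ×ˢ (univ : Finset (Fin d × Fin 1 → ℤˣ))) = (N - #S) * M := by
      rw [card_product, card_compl, card_univ]
    rw [← h1]
    refine card_le_card fun ω hω => ?_
    have hω' : IsEmbeddingOf ε P (selectionMatrix ω.1 * signMatrix ω.2) := by
      simpa using hω
    simp only [mem_product, mem_univ, and_true, mem_compl, hS, mem_filter, true_and]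
    rintro ⟨a, b, hab⟩
    exact hω'.not_isBadPair hε1 a b hab
  have hN : 0 < N := Fintype.card_pos
  have hM : 0 < M := Fintype.card_pos
  have hSN : #S ≤ N := card_le_univ S
  have hr : (1 - δ) * (N * M) ≤ G := by
    have h2 := ENNReal.toReal_mono (ENNReal.div_ne_top (ENNReal.natCast_ne_top _) (by
      exact_mod_cast (Nat.mul_pos hN hM).ne')) h
    rw [ENNReal.toReal_ofReal (by linarith), ENNReal.toReal_div, ENNReal.toReal_natCast,
      ENNReal.toReal_natCast, le_div_iff₀ (by exact_mod_cast Nat.mul_pos hN hM)] at h2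
    exact_mod_cast h2
  have hG' : (G : ℝ) ≤ (N - #S) * M := by
    have : (G : ℝ) ≤ ((N - #S : ℕ) : ℝ) * M := by exact_mod_cast hG
    rwa [Nat.cast_sub hSN] at this
  have hM' : (0 : ℝ) < M := by exact_mod_cast hM
  have : (1 - δ) * N ≤ N - #S := by
    refine le_of_mul_le_mul_right ?_ hM'
    linarith
  linarith

/-! ### Heavy entries force bad pairs -/

open Classical in
/-- Among columns of bounded length that are all heavy in one row there are many bad pairs. -/
theorem card_bad_ge_of_heavy_row {m n : ℕ} {ε : ℝ} (hε : 0 < ε) (hε1 : ε ≤ 1 / 6)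
    {P : Matrix (Fin m) (Fin n) ℝ} {r : Fin m} {C : Finset (Fin n)}
    (hlen : ∀ u ∈ C, columnInner P u u ≤ (1 + ε) ^ 2) (hheavy : ∀ u ∈ C, √(8 * ε) ≤ |P r u|) :
    2 * ε * (#C : ℝ) ^ 2 - #C ≤ #{p ∈ C ×ˢ C | IsBadPair ε P p.1 p.2} := by
  let τ : Fin n → ℝ := fun u => SignType.sign (P r u)
  have hτ : ∀ u, τ u * P r u = |P r u| := fun u => sign_mul_self _
  have hτ1 : ∀ u, |τ u| ≤ 1 := fun u => by
    simp only [τ]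
    rcases lt_trichotomy (P r u) 0 with h | h | h <;> simp [h]
  let q : Fin n × Fin n → ℝ := fun p => τ p.1 * τ p.2 * columnInner P p.1 p.2
    - |P r p.1| * |P r p.2|
  -- After removing row `r`, the signed Gram sum is a sum of squares, one for each remaining row.
  have hpos : 0 ≤ ∑ p ∈ C ×ˢ C, q p := by
    have hq : ∀ p, q p = ∑ i ∈ univ.erase r, (τ p.1 * P i p.1) * (τ p.2 * P i p.2) := by
      intro p
      simp only [q, columnInner, ← hτ]
      rw [← add_sum_erase univ _ (mem_univ r), mul_add, mul_sum]
      rw [show τ p.1 * τ p.2 * (P r p.1 * P r p.2) = τ p.1 * P r p.1 * (τ p.2 * P r p.2) by ring,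
        add_sub_cancel_left]
      exact sum_congr rfl fun i _ => by ring
    simp only [hq]
    rw [sum_comm]
    refine sum_nonneg fun i _ => ?_
    rw [sum_product' C C (fun u v => (τ u * P i u) * (τ v * P i v)), ← sum_mul_sum]
    exact mul_self_nonneg _
  have hprod : ∀ u ∈ C, ∀ v ∈ C, 8 * ε ≤ |P r u| * |P r v| := fun u hu v hv => by
    rw [← Real.mul_self_sqrt (by positivity : 0 ≤ 8 * ε)]
    exact mul_le_mul (hheavy u hu) (hheavy v hv) (Real.sqrt_nonneg _) (abs_nonneg _)
  have hττ : ∀ u v, |τ u * τ v| ≤ 1 := fun u v => by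
    rw [abs_mul]; exact mul_le_one₀ (hτ1 u) (abs_nonneg _) (hτ1 v)
  have habs : ∀ u v, τ u * τ v * columnInner P u v ≤ |columnInner P u v| := fun u v =>
    (le_abs_self _).trans (by
      rw [abs_mul]; exact mul_le_of_le_one_left (abs_nonneg _) (hττ u v))
  have hε2 : (1 + ε) ^ 2 ≤ 2 := by nlinarith
  have hCS : ∀ u ∈ C, ∀ v ∈ C, |columnInner P u v| ≤ 2 := fun u hu v hv => by
    have h1 : columnInner P u v ^ 2 ≤ columnInner P u u * columnInner P v v := by
      have := sum_mul_sq_le_sq_mul_sq univ (fun r => P r u) (fun r => P r v)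
      simpa only [columnInner, ← sq] using this
    have h0 : ∀ u, 0 ≤ columnInner P u u := fun u => sum_nonneg fun r _ => mul_self_nonneg _
    refine abs_le_of_sq_le_sq ?_ (by norm_num)
    nlinarith [hlen u hu, hlen v hv, h0 u, h0 v,
      mul_le_mul ((hlen u hu).trans hε2) ((hlen v hv).trans hε2) (h0 v) (by norm_num)]
  -- A good off-diagonal pair gives at most `2ε - 8ε`; any other gives at most `2 - 8ε ≤ 3 - 6ε`.
  -- The slack to `3` makes the final division by `3` clean.
  have hbound : ∀ p ∈ C ×ˢ C, q p ≤ -(6 * ε) + (if p.1 = p.2 then 3 else 0)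
      + (if IsBadPair ε P p.1 p.2 then 3 else 0) := by
    rintro ⟨u, v⟩ hp
    obtain ⟨hu, hv⟩ := mem_product.mp hp
    have h1 := hprod u hu v hv
    have h2 := habs u v
    have h3 := hCS u hu v hv
    simp only [q]
    by_cases huv : u = v
    · rw [if_pos huv]
      split_ifs <;> linarith
    · rw [if_neg huv]
      by_cases hb : IsBadPair ε P u v
      · rw [if_pos hb]; linarith
      · rw [if_neg hb]
        have : |columnInner P u v| ≤ 2 * ε := by
          by_contra hcon
          exact hb ⟨huv, fun h => hcon h.2.2⟩
        linarith
  have hsum := hpos.trans (sum_le_sum hbound)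
  rw [sum_add_distrib, sum_add_distrib, sum_const, card_product, nsmul_eq_mul, ← sum_filter
    (fun p : Fin n × Fin n => IsBadPair ε P p.1 p.2), sum_const, nsmul_eq_mul,
    sum_product' C C (fun u v => if u = v then (3 : ℝ) else 0)] at hsum
  simp only [sum_ite_eq] at hsum
  rw [sum_congr rfl fun x hx => if_pos hx, sum_const, nsmul_eq_mul] at hsum
  push_cast at hsum
  linarith

theorem card_nonzero_le_columnSparsity {m n : ℕ} (P : Matrix (Fin m) (Fin n) ℝ) (u : Fin n) :
    #{r | P r u ≠ 0} ≤ columnSparsity P :=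
  le_sup (f := fun j => #{i | P i j ≠ 0}) (mem_univ u)

theorem heavy_subset_nonzero {m n : ℕ} (P : Matrix (Fin m) (Fin n) ℝ) {θ : ℝ} (hθ : 0 < θ)
    (u : Fin n) : ({r | θ ≤ |P r u|} : Finset (Fin m)) ⊆ ({r | P r u ≠ 0} : Finset (Fin m)) := by
  intro r hr
  simp only [mem_filter, mem_univ, true_and] at hr ⊢
  exact abs_pos.mp (hθ.trans_le hr)

open Classical in
/-- Columns of bounded length with many heavy entries in total contain many bad pairs. -/
theorem sq_card_heavy_le {m n : ℕ} {ε : ℝ} (hε : 0 < ε) (hε1 : ε ≤ 1 / 6)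
    {P : Matrix (Fin m) (Fin n) ℝ} {L : Finset (Fin n)}
    (hlen : ∀ u ∈ L, columnInner P u u ≤ (1 + ε) ^ 2) {S : ℝ}
    (hS : S = ∑ u ∈ L, (#{r | √(8 * ε) ≤ |P r u|} : ℝ)) :
    2 * ε * S ^ 2 ≤ m * (S + columnSparsity P * #{p ∈ L ×ˢ L | IsBadPair ε P p.1 p.2}) := by
  have hθ : 0 < √(8 * ε) := Real.sqrt_pos.mpr (by positivity)
  let C : Fin m → Finset (Fin n) := fun r => {u ∈ L | √(8 * ε) ≤ |P r u|}
  set T : Finset (Fin n × Fin n) := {p ∈ L ×ˢ L | IsBadPair ε P p.1 p.2} with hT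
  have hC : ∑ r, (#(C r) : ℝ) = S := by
    rw [hS]
    exact_mod_cast sum_card_bipartiteAbove_eq_sum_card_bipartiteBelow
      (s := (univ : Finset (Fin m))) (t := L) fun r u => √(8 * ε) ≤ |P r u|
  have hrow : ∀ r, 2 * ε * (#(C r) : ℝ) ^ 2 - #(C r) ≤
      #{p ∈ T | √(8 * ε) ≤ |P r p.1| ∧ √(8 * ε) ≤ |P r p.2|} := by
    intro r
    refine (card_bad_ge_of_heavy_row hε hε1 (C := C r)
      (fun u hu => hlen u (mem_filter.mp hu).1) fun u hu => (mem_filter.mp hu).2).trans ?_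
    refine Nat.cast_le.mpr (card_le_card fun p hp => ?_)
    simp only [C, hT, mem_filter, mem_product] at hp ⊢
    tauto
  -- A pair is counted only in rows where its first column is nonzero.
  have hcount : (∑ r, (#{p ∈ T | √(8 * ε) ≤ |P r p.1| ∧ √(8 * ε) ≤ |P r p.2|} : ℝ)) ≤
      columnSparsity P * #T := by
    have h1 : ∑ r, #{p ∈ T | √(8 * ε) ≤ |P r p.1| ∧ √(8 * ε) ≤ |P r p.2|} =
        ∑ p ∈ T, #{r | √(8 * ε) ≤ |P r p.1| ∧ √(8 * ε) ≤ |P r p.2|} :=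
      sum_card_bipartiteAbove_eq_sum_card_bipartiteBelow
        (s := (univ : Finset (Fin m))) (t := T)
        fun r (p : Fin n × Fin n) => √(8 * ε) ≤ |P r p.1| ∧ √(8 * ε) ≤ |P r p.2|
    have h2 : ∑ p ∈ T, #{r | √(8 * ε) ≤ |P r p.1| ∧ √(8 * ε) ≤ |P r p.2|} ≤
        #T • columnSparsity P := by
      refine sum_le_card_nsmul _ _ _ fun p _ => ?_
      refine (card_le_card fun r hr => ?_).trans (card_nonzero_le_columnSparsity P p.1)
      exact heavy_subset_nonzero P hθ p.1 (by simp at hr ⊢; exact hr.1)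
    rw [smul_eq_mul, mul_comm #T] at h2
    exact_mod_cast h1.trans_le h2
  have hsum := (sum_le_sum fun r (_ : r ∈ univ) => hrow r).trans hcount
  rw [sum_sub_distrib, hC, ← mul_sum] at hsum
  have hCS : (∑ r, (#(C r) : ℝ)) ^ 2 ≤ #(univ : Finset (Fin m)) * ∑ r, (#(C r) : ℝ) ^ 2 :=
    sq_sum_le_card_mul_sum_sq
  rw [hC, card_univ, Fintype.card_fin] at hCS
  calc 2 * ε * S ^ 2 ≤ 2 * ε * (m * ∑ r, (#(C r) : ℝ) ^ 2) :=
        mul_le_mul_of_nonneg_left hCS (by positivity)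
    _ = m * (2 * ε * ∑ r, (#(C r) : ℝ) ^ 2) := by ring
    _ ≤ _ := mul_le_mul_of_nonneg_left (by linarith) (by positivity)

open Classical in
/-- A column that is in few bad pairs is not too long. -/
theorem columnInner_self_le_of_low_degree {m n : ℕ} [NeZero n] {ε : ℝ}
    {P : Matrix (Fin m) (Fin n) ℝ} {x : ℝ} (hx : x < 1 - 1 / n) {u : Fin n}
    (h : (𝔼 v, if IsBadPair ε P u v then (1 : ℝ) else 0) ≤ x) :
    columnInner P u u ≤ (1 + ε) ^ 2 := by
  by_contra hcon
  -- A column that is too long is bad with every other column, so its relative degree is `1 - 1 /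
  -- n`.
  have hbad : ∀ v, (if IsBadPair ε P u v then (1 : ℝ) else 0) = 1 - if v = u then 1 else 0 := by
    intro v
    by_cases hv : v = u
    · simp [hv, IsBadPair]
    · rw [if_pos ⟨Ne.symm hv, fun h' => hcon h'.1⟩, if_neg hv, sub_zero]
  have hn : (n : ℝ) ≠ 0 := by exact_mod_cast NeZero.ne n
  simp only [hbad, Fintype.expect_eq_sum_div_card, sum_sub_distrib, sum_const, card_univ,
    Fintype.card_fin, nsmul_eq_mul, mul_one, sum_ite_eq', mem_univ, if_true] at h
  rw [sub_div, div_self hn] at h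
  linarith

/-! ### Combining the two bounds -/

/-- The numerical contradiction between few bad pairs and many heavy entries. -/
theorem false_of_heavy_bounds {ε δ m n d k s S T : ℝ} (hε : 0 < ε) (hδ : 0 < δ)
    (hδ1 : δ < 1 / 2000) (hm : 0 ≤ m) (hn0 : 0 < n) (hd0 : 0 ≤ d) (hdk : d ≤ 3 * k)
    (hnd : d ^ 2 ≤ δ * n) (hsp : s ≤ 1 / (9 * ε)) (hm' : m ≤ d ^ 2) (hT0 : 0 ≤ T)
    (hT : k ^ 2 * T ≤ 4 * δ * n ^ 2) (hSn : n ≤ 24 * (ε * S))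
    (hmain : 2 * ε * S ^ 2 ≤ m * (S + s * T)) : False := by
  have hS0 : 0 < ε * S := by linarith
  have hTd : d ^ 2 * T ≤ 36 * δ * n ^ 2 := by
    have h1 : d ^ 2 ≤ 9 * k ^ 2 := by nlinarith
    calc d ^ 2 * T ≤ 9 * k ^ 2 * T := mul_le_mul_of_nonneg_right h1 hT0
      _ = 9 * (k ^ 2 * T) := by ring
      _ ≤ 9 * (4 * δ * n ^ 2) := mul_le_mul_of_nonneg_left hT (by norm_num)
      _ = _ := by ring
  have hεsp : ε * s ≤ 1 / 9 := by
    rw [le_div_iff₀ (by positivity)] at hsp; linarith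
  -- `2328 = 24 + 4 · 24²`, and `2328δ < 2` since `δ < 1/2000`.
  have hchain : 2 * (ε * S) ^ 2 ≤ 2328 * δ * (ε * S) ^ 2 := by
    calc 2 * (ε * S) ^ 2 = ε * (2 * ε * S ^ 2) := by ring
      _ ≤ ε * (m * (S + s * T)) := mul_le_mul_of_nonneg_left hmain hε.le
      _ = m * (ε * S + ε * s * T) := by ring
      _ ≤ m * (ε * S + 1 / 9 * T) := by gcongr
      _ ≤ d ^ 2 * (ε * S + 1 / 9 * T) := by gcongr
      _ = d ^ 2 * (ε * S) + 1 / 9 * (d ^ 2 * T) := by ring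
      _ ≤ δ * n * (ε * S) + 1 / 9 * (36 * δ * n ^ 2) := by gcongr
      _ ≤ δ * (24 * (ε * S)) * (ε * S) + 1 / 9 * (36 * δ * (24 * (ε * S)) ^ 2) := by gcongr
      _ = _ := by ring
  have := mul_pos hS0 hS0
  nlinarith

open Classical in
/-- A sparse embedding of the hard distribution with many heavy entries has more than `d ^ 2`
rows. -/
theorem IsEmbeddingFor.sq_lt_rows {ε δ : ℝ} {m n d : ℕ} [NeZero n] {P : Matrix (Fin m) (Fin n) ℝ}
    (hε : 0 < ε) (hε1 : ε < 1 / 6) (hδ : 0 < δ) (hδ1 : δ < 1 / 2000) (hd : 1 / ε ^ 2 ≤ (d : ℝ))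
    (hnd : (d : ℝ) ^ 2 ≤ δ * n) (hsp : (columnSparsity P : ℝ) ≤ 1 / (9 * ε))
    (hav : 1 / (12 * ε) ≤ averageHeavy (√(8 * ε)) P)
    (hemb : IsEmbeddingFor ε δ P (hardDistribution n d 1)) : d ^ 2 < m := by
  by_contra hm
  have hn0 : (0 : ℝ) < n := by exact_mod_cast Nat.pos_of_ne_zero (NeZero.ne n)
  have hdR : (36 : ℝ) ≤ d := by
    refine le_trans ?_ hd
    rw [le_div_iff₀ (by positivity)]
    nlinarith
  have hd36 : 36 ≤ d := by exact_mod_cast hdR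
  have hn3 : (3 : ℝ) ≤ n := by nlinarith
  -- The index set must hold two disjoint blocks of size `k`; `d ≥ 36` keeps the rounding loss
  -- within `d ≤ 3 * k`.
  obtain ⟨k, hk⟩ : ∃ k, k = d / 2 := ⟨_, rfl⟩
  have hk18 : 18 ≤ k := by omega
  have hk0 : 0 < k := by omega
  have hdk : (d : ℝ) ≤ 3 * k := by exact_mod_cast (by omega : d ≤ 3 * k)
  have hk18' : (18 : ℝ) ≤ k := by exact_mod_cast hk18
  have hJ : Fintype.card (Fin d × Fin 1) = d := by simp
  obtain ⟨A, -, hA⟩ := exists_subset_card_eq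
    (s := (univ : Finset (Fin d × Fin 1))) (n := k) (by rw [card_univ, hJ]; omega)
  obtain ⟨B, hBA, hB⟩ := exists_subset_card_eq (s := Aᶜ) (n := k)
    (by rw [card_compl, hJ, hA]; omega)
  have hAB : Disjoint A B := disjoint_right.mpr fun x hx => mem_compl.mp (hBA hx)
  have hhit := hemb.card_bad_le (by linarith) (by linarith)
  have hmem : ∀ (c : Fin d × Fin 1 → Fin n) a b, IsBadPair ε P (c a) (c b) →
      c ∈ ({c | ∃ a b, IsBadPair ε P (c a) (c b)} : Finset (Fin d × Fin 1 → Fin n)) :=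
    fun c a b h => by simp only [mem_filter, mem_univ, true_and]; exact ⟨a, b, h⟩
  have hH := card_high_degree_le hk0 hAB hA hB hmem (by linarith) hhit
  set H : Finset (Fin n) :=
    {u | 1 / (k : ℝ) < 𝔼 v, if IsBadPair ε P u v then (1 : ℝ) else 0} with hHdef
  have hL : ∀ u ∈ Hᶜ, (𝔼 v, if IsBadPair ε P u v then (1 : ℝ) else 0) ≤ 1 / k := fun u hu => by
    simpa [hHdef] using hu
  have hT := card_low_degree_pairs_le (fun _ _ h => h.symm) hk0 hAB hA hB hmem (by linarith)
    hhit hL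
  have hlen : ∀ u ∈ Hᶜ, columnInner P u u ≤ (1 + ε) ^ 2 := fun u hu => by
    refine columnInner_self_le_of_low_degree ?_ (hL u hu)
    have h1 : 1 / (k : ℝ) ≤ 1 / 18 := one_div_le_one_div_of_le (by norm_num) hk18'
    have h2 : 1 / (n : ℝ) ≤ 1 / 3 := one_div_le_one_div_of_le (by norm_num) hn3
    linarith
  have hmain := sq_card_heavy_le hε hε1.le hlen rfl
  set T : ℝ := ((#{p ∈ Hᶜ ×ˢ Hᶜ | IsBadPair ε P p.1 p.2} : ℕ) : ℝ)
  set S : ℝ := ∑ u ∈ Hᶜ, (#{r | √(8 * ε) ≤ |P r u|} : ℝ) with hS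
  rw [Fintype.card_fin] at hH hT
  have hHn : (#H : ℝ) ≤ n / 1000 := by
    have h1 : 18 * (#H : ℝ) ≤ k * #H := mul_le_mul_of_nonneg_right hk18' (by positivity)
    nlinarith
  have hHS : ∑ u ∈ H, (#{r | √(8 * ε) ≤ |P r u|} : ℝ) ≤ #H * (1 / (9 * ε)) := by
    rw [← nsmul_eq_mul]
    refine sum_le_card_nsmul _ _ _ fun u _ => le_trans ?_ hsp
    exact_mod_cast (card_le_card (heavy_subset_nonzero P
      (Real.sqrt_pos.mpr (by positivity)) u)).trans (card_nonzero_le_columnSparsity P u)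
  -- Discarding `H` costs at most `#H / (9ε) ≤ n / (9000ε)` heavy entries, well below half of the
  -- assumed total `n / (12ε)`.
  have hSn : (n : ℝ) ≤ 24 * (ε * S) := by
    rw [averageHeavy, le_div_iff₀ hn0, ← sum_add_sum_compl H] at hav
    have h1 : 1 / (12 * ε) * n ≤ #H * (1 / (9 * ε)) + S := hav.trans (by linarith)
    have h2 := mul_le_mul_of_nonneg_left h1 hε.le
    have h3 : ε * (1 / (12 * ε) * n) = n / 12 := by field_simp
    have h4 : ε * (#H * (1 / (9 * ε)) + S) = #H / 9 + ε * S := by field_simp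
    rw [h3, h4] at h2
    linarith
  have hT0 : 0 ≤ T := by positivity
  have hm' : (m : ℝ) ≤ (d : ℝ) ^ 2 := by exact_mod_cast not_lt.mp hm
  exact false_of_heavy_bounds hε hδ hδ1 (by positivity) hn0 (by positivity) hdk hnd hsp hm' hT0 hT
    hSn hmain

end SubspaceEmbedding

theorem mainTheorem2 :
    ∃ ε₀ δ₀ K₀ : ℝ, 0 < ε₀ ∧ 0 < δ₀ ∧ 0 < K₀ ∧
      ∀ (ε δ : ℝ) (m n d : ℕ) [NeZero n] (P : Matrix (Fin m) (Fin n) ℝ),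
        0 < ε → ε < ε₀ → 0 < δ → δ < δ₀ →
        1 / ε ^ 2 ≤ (d : ℝ) →
        K₀ * (d : ℝ) ^ 2 / δ ≤ (n : ℝ) →
        (SubspaceEmbedding.columnSparsity P : ℝ) ≤ 1 / (9 * ε) →
        1 / (12 * ε) ≤ SubspaceEmbedding.averageHeavy (√(8 * ε)) P →
        SubspaceEmbedding.IsEmbeddingFor ε δ P
          (SubspaceEmbedding.hardDistribution n d 1) →
        d ^ 2 < m := by
  refine ⟨1 / 6, 1 / 2000, 1, by norm_num, by norm_num, by norm_num, ?_⟩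
  intro ε δ m n d _ P hε hε1 hδ hδ1 hd hn hsp hav hemb
  refine hemb.sq_lt_rows hε hε1 hδ hδ1 hd ?_ hsp hav
  rwa [one_mul, div_le_iff₀ hδ, mul_comm] at hn
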